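/- Let $Y$ be a two-sided exponential random variable, i.e. a real random variable with law $\nu(dy)=\tfrac12 e^{-|y|}\,dy$ on $\mathbb{R}$, let $p>0$, and set $X=\operatorname{sign}(Y)\,|Y|^p$. Let $X_1,X_2,\dots$ be independent random variables with the same law as $X$, defined on a probability space with probability $\mathbb{P}$, and let $S_n=\frac1n\sum_{i=1}^n X_i$. We say that $(S_n)_{n\ge1}$ satisfies a large deviations principle at speed $v_n$ with rate function $I:\mathbb{R}\to[0,+\infty]$ if $I$ is lower semicontinuous and, for every Borel set $B\subset\mathbb{R}$, $$-\inf_{\mathring B} I\;\le\;\liminf_{n\to\infty}\frac1{v_n}\log\mathbb{P}(S_n\in B)\;\le\;\limsup_{n\to\infty}\frac1{v_n}\log\mathbb{P}(S_n\in B)\;\le\;-\inf_{\overline B} I,$$ where $\mathring B$ and $\overline B$ are the interior and the closure of $B$, $\log 0=-\infty$ and $\inf_\emptyset I=+\infty$. 1. If $p\in(0,1]$, then $(S_n)_{n\ge1}$ satisfies a large deviations principle at speed $n$ with rate function $$J(x)=\sup_{\eta\in\mathbb{R}}\{\eta x-\lambda(\eta)\},\qquad \lambda(\eta)=\log\mathbb{E}\big[e^{\eta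 X}\big]\in(-\infty,+\infty].$$ 2. If $p>1$, then $(S_n)_{n\ge1}$ satisfies a large deviations principle at speed $n^{1/p}$ with rate function $I_{1/p}(x)=|x|^{1/p}$. -/

import Mathlib

open MeasureTheory ProbabilityTheory Filter
open scoped ENNReal

noncomputable section

/-- The sequence `Z` of random variables on `(Ω, P)` satisfies a large deviations principle at
speed `v` with rate function `I`. Probabilities and their logarithms are extended-valued:
`log 0 = -∞`, and the infimum of `I` over the empty set is `+∞`. -/
def SatisfiesLDP {Ω S : Type*} [MeasurableSpace Ω] (P : Measure Ω)
    [TopologicalSpace S] [MeasurableSpace S] [BorelSpace S]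
    (Z : ℕ → Ω → S) (v : ℕ → ℝ) (I : S → EReal) : Prop :=
  (∀ z, 0 ≤ I z) ∧ LowerSemicontinuous I ∧
    ∀ B : Set S, MeasurableSet B →
      -(⨅ z ∈ interior B, I z) ≤
          liminf (fun n : ℕ => ENNReal.log (P {ω | Z n ω ∈ B}) / ((v n : ℝ) : EReal)) atTop ∧
        limsup (fun n : ℕ => ENNReal.log (P {ω | Z n ω ∈ B}) / ((v n : ℝ) : EReal)) atTop ≤
          -(⨅ z ∈ closure B, I z)

/-- The signed power `φ_p(x) = sign(x) |x|^p`. -/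
def signedPow (p x : ℝ) : ℝ := Real.sign x * |x| ^ p

/-- The two-sided exponential distribution `ν(dy) = (e^{-|y|} / 2) dy` on `ℝ`. -/
def twoSidedExponential : Measure ℝ :=
  volume.withDensity fun y => ENNReal.ofReal (Real.exp (-|y|) / 2)

/-- The empirical mean of the first `n` samples. -/
def empiricalMean {Ω : Type*} (X : ℕ → Ω → ℝ) (n : ℕ) (ω : Ω) : ℝ :=
  (1 / (n : ℝ)) * ∑ i ∈ Finset.range n, X i ω

/-- The free energy `λ(η) = log E[e^{η X}]`, equal to `+∞` where the expectation is infinite. -/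
def freeEnergy {Ω : Type*} [MeasurableSpace Ω] (P : Measure Ω) (X : Ω → ℝ) (η : ℝ) : EReal :=
  ENNReal.log (∫⁻ ω, ENNReal.ofReal (Real.exp (η * X ω)) ∂P)

/-- The Legendre transform `x ↦ sup_η {η x - L(η)}`. -/
def legendre (L : ℝ → EReal) (x : ℝ) : EReal :=
  ⨆ η : ℝ, (((η * x : ℝ) : EReal) - L η)

end

/-! Both rate functions vanish at `0`, so `SatisfiesLDP.of_halfLines` reduces the principle to upper
bounds on half-lines away from `0` and lower bounds on balls.

For `p ≤ 1` this is Cramér's theorem. The upper bound is Chernoff's. The lower bound at `x` weights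
by `e^{η S}`, with `η` chosen so that the slope of the cumulant generating function at `η` is `x`:
most of the weight then sits where `S ≈ n x`. Every real `x` is such a slope, because the cumulant
generating function outgrows every line before the domain of finiteness ends
(`exists_deriv_cgf_signedPow_eq`).

For `p > 1` a single summand of size about `n x` is the cheapest deviation: it requires `|Y| ≈ (n
x)^{1/p}`, at cost `n^{1/p} x^{1/p}`. The lower bound lets one variable jump while the others obey
the law of large numbers. For the upper bound, truncate at `T = n b`. A summand beyond `T` has
probability of order `e^{-θ T^{1/p}}` for each `θ < 1`. The truncated sum admits the tilt `θ T^{1/p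
- 1}`, small enough for its cumulant generating function to be quadratic, hence negligible after
summation, yet giving the same factor `e^{-θ T^{1/p}}`. -/

/-! ### Large deviations on the line from half-lines and balls. -/

theorem ENNReal.log_div_le_iff_le_ofReal_exp {q : ℝ≥0∞} {v c : ℝ} (hv : 0 < v) :
    ENNReal.log q / (v : EReal) ≤ (c : EReal) ↔ q ≤ ENNReal.ofReal (Real.exp (c * v)) := by
  rw [EReal.div_le_iff_le_mul (by exact_mod_cast hv) (EReal.coe_ne_top v),
    ← ENNReal.log_le_log_iff, ENNReal.log_ofReal_of_pos (Real.exp_pos _), Real.log_exp,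
    EReal.coe_mul, mul_comm]

theorem ENNReal.le_log_div_iff_ofReal_exp_le {q : ℝ≥0∞} {v c : ℝ} (hv : 0 < v) :
    (c : EReal) ≤ ENNReal.log q / (v : EReal) ↔ ENNReal.ofReal (Real.exp (c * v)) ≤ q := by
  rw [EReal.le_div_iff_mul_le (by exact_mod_cast hv) (EReal.coe_ne_top v),
    ← ENNReal.log_le_log_iff, ENNReal.log_ofReal_of_pos (Real.exp_pos _), Real.log_exp,
    EReal.coe_mul]

/-- For a rate function on `ℝ` which vanishes at `0`, a large deviations principle follows from
upper bounds on half-lines and lower bounds on balls. -/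
theorem SatisfiesLDP.of_halfLines {Ω : Type*} [MeasurableSpace Ω] {P : Measure Ω}
    [IsProbabilityMeasure P] {Z : ℕ → Ω → ℝ} {v : ℕ → ℝ} {I : ℝ → EReal}
    (hv : Tendsto v atTop atTop) (hnonneg : ∀ x, 0 ≤ I x) (hlsc : LowerSemicontinuous I)
    (hI0 : I 0 = 0)
    (hright : ∀ b > 0, ∀ c : ℝ, 0 ≤ c → (c : EReal) < I b →
      ∀ᶠ n in atTop, P {ω | b ≤ Z n ω} ≤ ENNReal.ofReal (Real.exp (-c * v n)))
    (hleft : ∀ a < 0, ∀ c : ℝ, 0 ≤ c → (c : EReal) < I a →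
      ∀ᶠ n in atTop, P {ω | Z n ω ≤ a} ≤ ENNReal.ofReal (Real.exp (-c * v n)))
    (hball : ∀ x, ∀ ε > 0, ∀ c : ℝ, I x < c →
      ∀ᶠ n in atTop, ENNReal.ofReal (Real.exp (-c * v n)) ≤ P {ω | |Z n ω - x| < ε}) :
    SatisfiesLDP P Z v I := by
  refine ⟨hnonneg, hlsc, fun B _ => ⟨?_, ?_⟩⟩
  · rw [EReal.neg_le]
    refine le_iInf₂ fun x hx => ?_
    rw [EReal.neg_le, ← EReal.ge_of_forall_gt_iff_ge]
    intro z hz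
    obtain ⟨ε, hε, hball'⟩ := Metric.isOpen_iff.1 isOpen_interior x hx
    have hz' : I x < ((-z : ℝ) : EReal) := by
      rw [EReal.coe_neg]; exact EReal.lt_neg_comm.1 hz
    refine le_liminf_of_le (by isBoundedDefault) ?_
    filter_upwards [hball x ε hε (-z) hz', hv.eventually_gt_atTop 0] with n hn hvn
    rw [ENNReal.le_log_div_iff_ofReal_exp_le hvn]
    rw [neg_neg] at hn
    refine hn.trans (measure_mono fun ω hω => ?_)
    refine interior_subset (s := B) (hball' ?_)
    simpa [Real.dist_eq] using hω
  · rw [← EReal.le_of_forall_lt_iff_le]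
    intro z hz
    have hz' : ((-z : ℝ) : EReal) < ⨅ x ∈ closure B, I x := by
      rw [EReal.coe_neg]; exact EReal.neg_lt_comm.1 hz
    refine limsup_le_of_le (by isBoundedDefault) ?_
    rcases lt_or_ge 0 z with hz0 | hz0
    · filter_upwards [hv.eventually_gt_atTop 0] with n hvn
      rw [ENNReal.log_div_le_iff_le_ofReal_exp hvn]
      refine prob_le_one.trans ?_
      rw [ENNReal.one_le_ofReal]
      exact Real.one_le_exp (by positivity)
    obtain ⟨c', hc1, hc2⟩ := EReal.lt_iff_exists_real_btwn.1 hz'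
    have hc1' : -z < c' := by exact_mod_cast hc1
    have hc'0 : 0 ≤ c' := by linarith
    -- As `0` is excluded, the points of `closure B` nearest to `0` on either side are nonzero and
    -- bound two half-lines covering `B`. Since they lie in `closure B`, their rates exceed `c'`; no
    -- monotonicity of `I` is needed.
    have h0 : (0 : ℝ) ∉ closure B := fun h => by
      have h1 := hc2.trans_le (biInf_le I h)
      rw [hI0] at h1
      exact absurd h1 (not_lt.2 (by exact_mod_cast hc'0))
    have hR : ∀ᶠ n in atTop, P {ω | Z n ω ∈ closure B ∩ Set.Ici 0} ≤
        ENNReal.ofReal (Real.exp (-c' * v n)) := by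
      have hcl : IsClosed (closure B ∩ Set.Ici (0 : ℝ)) := isClosed_closure.inter isClosed_Ici
      rcases (closure B ∩ Set.Ici (0 : ℝ)).eq_empty_or_nonempty with he | hne
      · simp [he]
      have hbdd : BddBelow (closure B ∩ Set.Ici (0 : ℝ)) := ⟨0, fun x hx => hx.2⟩
      have hmem := hcl.csInf_mem hne hbdd
      have hpos : 0 < sInf (closure B ∩ Set.Ici (0 : ℝ)) :=
        lt_of_le_of_ne hmem.2 fun h => h0 (h ▸ hmem.1)
      filter_upwards [hright _ hpos c' hc'0 (hc2.trans_le (biInf_le I hmem.1))] with n hn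
      refine (measure_mono fun ω hω => ?_).trans hn
      exact csInf_le hbdd hω
    have hL : ∀ᶠ n in atTop, P {ω | Z n ω ∈ closure B ∩ Set.Iic 0} ≤
        ENNReal.ofReal (Real.exp (-c' * v n)) := by
      have hcl : IsClosed (closure B ∩ Set.Iic (0 : ℝ)) := isClosed_closure.inter isClosed_Iic
      rcases (closure B ∩ Set.Iic (0 : ℝ)).eq_empty_or_nonempty with he | hne
      · simp [he]
      have hbdd : BddAbove (closure B ∩ Set.Iic (0 : ℝ)) := ⟨0, fun x hx => hx.2⟩
      have hmem := hcl.csSup_mem hne hbdd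
      have hneg : sSup (closure B ∩ Set.Iic (0 : ℝ)) < 0 :=
        lt_of_le_of_ne hmem.2 fun h => h0 (h ▸ hmem.1)
      filter_upwards [hleft _ hneg c' hc'0 (hc2.trans_le (biInf_le I hmem.1))] with n hn
      refine (measure_mono fun ω hω => ?_).trans hn
      exact le_csSup hbdd hω
    -- The slack between `-z` and `c'` absorbs the factor `2` from the two half-lines.
    have hgap : Tendsto (fun n => (c' + z) * v n) atTop atTop :=
      hv.const_mul_atTop (by linarith)
    filter_upwards [hR, hL, hv.eventually_gt_atTop 0,
      hgap.eventually_ge_atTop (Real.log 2)] with n hRn hLn hvn hgn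
    rw [ENNReal.log_div_le_iff_le_ofReal_exp hvn]
    calc P {ω | Z n ω ∈ B}
        ≤ P ({ω | Z n ω ∈ closure B ∩ Set.Ici 0} ∪ {ω | Z n ω ∈ closure B ∩ Set.Iic 0}) := by
          refine measure_mono fun ω hω => ?_
          rcases le_total 0 (Z n ω) with h | h
          · exact Or.inl ⟨subset_closure hω, h⟩
          · exact Or.inr ⟨subset_closure hω, h⟩
      _ ≤ ENNReal.ofReal (Real.exp (-c' * v n)) + ENNReal.ofReal (Real.exp (-c' * v n)) :=
          (measure_union_le _ _).trans (add_le_add hRn hLn)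
      _ = ENNReal.ofReal (2 * Real.exp (-c' * v n)) := by
          rw [← ENNReal.ofReal_add (Real.exp_nonneg _) (Real.exp_nonneg _), two_mul]
      _ ≤ ENNReal.ofReal (Real.exp (z * v n)) := by
          refine ENNReal.ofReal_le_ofReal ?_
          calc 2 * Real.exp (-c' * v n)
              = Real.exp (Real.log 2) * Real.exp (-c' * v n) := by
                rw [Real.exp_log (by norm_num)]
            _ = Real.exp (Real.log 2 + -c' * v n) := (Real.exp_add _ _).symm
            _ ≤ _ := Real.exp_le_exp.2 (by linarith)

/-! ### Exponential bounds for i.i.d. sums. -/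

theorem le_empiricalMean_iff {Ω : Type*} {X : ℕ → Ω → ℝ} {n : ℕ} (hn : 0 < n) {b : ℝ} {ω : Ω} :
    b ≤ empiricalMean X n ω ↔ n * b ≤ (∑ i ∈ Finset.range n, X i) ω := by
  have : (0 : ℝ) < n := by exact_mod_cast hn
  rw [empiricalMean, one_div, ← div_eq_inv_mul, le_div_iff₀ this, mul_comm, Finset.sum_apply]

theorem empiricalMean_neg {Ω : Type*} (X : ℕ → Ω → ℝ) (n : ℕ) (ω : Ω) :
    empiricalMean (fun i ω => -X i ω) n ω = -empiricalMean X n ω := by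
  simp [empiricalMean]

section IID

variable {Ω Ω' : Type*} [MeasurableSpace Ω] [MeasurableSpace Ω'] {P : Measure Ω} {Q : Measure Ω'}
  {X : ℕ → Ω → ℝ} {W : Ω' → ℝ}

theorem mgf_sum_range_eq_pow (hindep : iIndepFun X P) (hid : ∀ i, IdentDistrib (X i) W P Q)
    (n : ℕ) (t : ℝ) : mgf (∑ i ∈ Finset.range n, X i) P t = mgf W Q t ^ n := by
  rw [hindep.mgf_sum₀ fun i => (hid i).aemeasurable_fst]
  simp [fun i => congrFun (mgf_congr_identDistrib (hid i)) t]

variable [IsProbabilityMeasure Q]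

theorem integrable_exp_mul_sum_range (hindep : iIndepFun X P)
    (hid : ∀ i, IdentDistrib (X i) W P Q) (n : ℕ) {t : ℝ}
    (ht : Integrable (fun ω => Real.exp (t * W ω)) Q) :
    Integrable (fun ω => Real.exp (t * (∑ i ∈ Finset.range n, X i) ω)) P := by
  -- A non-integrable exponential would give `mgf` its default value `0`, whereas here it is a power
  -- of a positive number.
  by_contra h
  have h1 := mgf_undef h
  rw [mgf_sum_range_eq_pow hindep hid] at h1
  exact (pow_pos (mgf_pos ht) n).ne' h1

theorem mgf_sum_range_eq_exp (hindep : iIndepFun X P) (hid : ∀ i, IdentDistrib (X i) W P Q)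
    (n : ℕ) {t : ℝ} (ht : Integrable (fun ω => Real.exp (t * W ω)) Q) :
    mgf (∑ i ∈ Finset.range n, X i) P t = Real.exp (n * cgf W Q t) := by
  rw [mgf_sum_range_eq_pow hindep hid, ← exp_cgf ht, ← Real.exp_nat_mul]

variable [IsProbabilityMeasure P]

/-- Chernoff's bound for the upper tail of an empirical mean. -/
theorem measure_le_empiricalMean_le (hindep : iIndepFun X P)
    (hid : ∀ i, IdentDistrib (X i) W P Q) {t : ℝ} (ht0 : 0 ≤ t)
    (ht : Integrable (fun ω => Real.exp (t * W ω)) Q) (b : ℝ) {n : ℕ} (hn : 0 < n) :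
    P {ω | b ≤ empiricalMean X n ω} ≤ ENNReal.ofReal (Real.exp (-(t * b - cgf W Q t) * n)) := by
  simp_rw [le_empiricalMean_iff hn]
  rw [← ofReal_measureReal]
  refine ENNReal.ofReal_le_ofReal ?_
  refine (measure_ge_le_exp_mul_mgf _ ht0 (integrable_exp_mul_sum_range hindep hid n ht)).trans ?_
  rw [mgf_sum_range_eq_exp hindep hid n ht, ← Real.exp_add]
  exact Real.exp_le_exp.2 (le_of_eq (by ring))

/-- Cramér's lower bound at a point which is a slope of the cumulant generating function. -/
theorem eventually_le_measure_empiricalMean_near (hindep : iIndepFun X P)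
    (hid : ∀ i, IdentDistrib (X i) W P Q) {η x ε c : ℝ}
    (hη : η ∈ interior (integrableExpSet W Q)) (hx : deriv (cgf W Q) η = x) (hε : 0 < ε)
    (hc : η * x - cgf W Q η < c) :
    ∀ᶠ n : ℕ in atTop, ENNReal.ofReal (Real.exp (-c * n)) ≤
      P {ω | |empiricalMean X n ω - x| < ε} := by
  set gap := c - (η * x - cgf W Q η) with hgap
  have hgap0 : 0 < gap := by linarith
  -- The radius is shrunk so that on the event `|S - n x| < n r` the weight `e^{η S}` varies by at
  -- most `e^{n gap / 2}`.
  obtain ⟨r, hr0, hrε, hrη⟩ : ∃ r > 0, r ≤ ε ∧ |η| * r ≤ gap / 2 := by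
    refine ⟨min ε (gap / 2 / (|η| + 1)), by positivity, min_le_left _ _, ?_⟩
    calc |η| * min ε (gap / 2 / (|η| + 1)) ≤ |η| * (gap / 2 / (|η| + 1)) := by
          gcongr; exact min_le_right _ _
      _ ≤ (|η| + 1) * (gap / 2 / (|η| + 1)) := by gcongr; linarith
      _ = gap / 2 := by field_simp
  have hderiv : HasDerivAt (cgf W Q) x η := hx ▸ (analyticAt_cgf hη).differentiableAt.hasDerivAt
  obtain ⟨δ, hδ0, hδp, hδm, hpint, hmint⟩ : ∃ δ > 0,
      cgf W Q (η + δ) ≤ cgf W Q η + δ * x + δ * r / 2 ∧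
      cgf W Q (η - δ) ≤ cgf W Q η - δ * x + δ * r / 2 ∧
      η + δ ∈ integrableExpSet W Q ∧ η - δ ∈ integrableExpSet W Q := by
    have h1 : ∀ᶠ h in nhds (0 : ℝ), |cgf W Q (η + h) - cgf W Q η - h * x| ≤ r / 2 * |h| := by
      simpa using (hasDerivAt_iff_isLittleO_nhds_zero.1 hderiv).bound (half_pos hr0)
    have h2 : ∀ᶠ h in nhds (0 : ℝ), η + h ∈ integrableExpSet W Q := by
      have : Tendsto (fun h : ℝ => η + h) (nhds 0) (nhds η) := by
        simpa using (continuous_const.add continuous_id).tendsto (0 : ℝ) (f := fun h : ℝ => η + h)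
      exact this.eventually (mem_interior_iff_mem_nhds.1 hη)
    obtain ⟨s, hs, hball⟩ := Metric.eventually_nhds_iff.1 (h1.and h2)
    have hp := hball (y := s / 2) (by rw [Real.dist_eq, sub_zero, abs_of_pos] <;> linarith)
    have hm := hball (y := -(s / 2)) (by
      rw [Real.dist_eq, sub_zero, abs_neg, abs_of_pos] <;> linarith)
    refine ⟨s / 2, by positivity, ?_, ?_, hp.2, by simpa [sub_eq_add_neg] using hm.2⟩
    · have := (abs_le.1 hp.1).2
      rw [abs_of_pos (half_pos hs)] at this
      linarith
    · have := (abs_le.1 hm.1).2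
      rw [abs_neg, abs_of_pos (half_pos hs), ← sub_eq_add_neg] at this
      linarith
  have hηint := interior_subset hη
  have hlim1 : Tendsto (fun n : ℕ => δ * r / 2 * (n : ℝ)) atTop atTop :=
    tendsto_natCast_atTop_atTop.const_mul_atTop (by positivity)
  have hlim2 : Tendsto (fun n : ℕ => gap / 2 * (n : ℝ)) atTop atTop :=
    tendsto_natCast_atTop_atTop.const_mul_atTop (by positivity)
  filter_upwards [hlim1.eventually_ge_atTop (Real.log 4), hlim2.eventually_ge_atTop (Real.log 2),
    eventually_gt_atTop 0] with n hn1 hn2 hn0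
  have hn0' : (0 : ℝ) < n := by exact_mod_cast hn0
  set S : Ω → ℝ := ∑ i ∈ Finset.range n, X i with hS
  have hSm : AEMeasurable S P := Finset.aemeasurable_sum _ fun i _ => (hid i).aemeasurable_fst
  set A : Set Ω := {ω | |S ω - n * x| < n * r} with hA
  have hAm : NullMeasurableSet A P :=
    nullMeasurableSet_lt ((hSm.sub_const _).norm) aemeasurable_const
  have hsub : A ⊆ {ω | |empiricalMean X n ω - x| < ε} := by
    intro ω hω
    have h1 : S ω - n * x = n * (empiricalMean X n ω - x) := by
      rw [empiricalMean, hS, Finset.sum_apply]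
      field_simp
    have h2 : |S ω - n * x| < n * r := hω
    rw [h1, abs_mul, abs_of_pos hn0'] at h2
    exact (lt_of_mul_lt_mul_left h2 hn0'.le).trans_le hrε
  -- Off `A`, a further tilt by `±δ` dominates the weight. By the first-order expansion at `η`, each
  -- tilted term has expectation at most `e^{n cgf η - n δ r / 2}`, eventually a quarter of the
  -- total weight, so `A` carries at least half of it.
  have hpoint : ∀ ω, Real.exp (η * S ω) ≤
      A.indicator (fun _ => Real.exp (n * (η * x + gap / 2))) ω +
      Real.exp (-(n * (δ * (x + r)))) * Real.exp ((η + δ) * S ω) +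
      Real.exp (n * (δ * (x - r))) * Real.exp ((η - δ) * S ω) := by
    intro ω
    by_cases hω : ω ∈ A
    · rw [Set.indicator_of_mem hω]
      have h2 : |S ω - n * x| < n * r := hω
      have h3 : η * (S ω - n * x) ≤ n * (gap / 2) :=
        calc η * (S ω - n * x) ≤ |η * (S ω - n * x)| := le_abs_self _
          _ = |η| * |S ω - n * x| := abs_mul _ _
          _ ≤ |η| * (n * r) := by gcongr
          _ = n * (|η| * r) := by ring
          _ ≤ n * (gap / 2) := by gcongr
      have h4 : Real.exp (η * S ω) ≤ Real.exp (n * (η * x + gap / 2)) :=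
        Real.exp_le_exp.2 (by linarith)
      have h5 := Real.exp_pos (-(n * (δ * (x + r))))
      have h6 := Real.exp_pos ((η + δ) * S ω)
      have h7 := Real.exp_pos (n * (δ * (x - r)))
      have h8 := Real.exp_pos ((η - δ) * S ω)
      have := mul_pos h5 h6
      have := mul_pos h7 h8
      linarith
    · rw [Set.indicator_of_notMem hω, zero_add, ← Real.exp_add, ← Real.exp_add]
      have h2 : n * r ≤ |S ω - n * x| := not_lt.1 hω
      rcases le_abs.1 h2 with h | h
      · refine le_add_of_le_of_nonneg (Real.exp_le_exp.2 ?_) (Real.exp_nonneg _)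
        nlinarith
      · refine le_add_of_nonneg_of_le (Real.exp_nonneg _) (Real.exp_le_exp.2 ?_)
        nlinarith
  have hindicator : Integrable (A.indicator fun _ => Real.exp (n * (η * x + gap / 2))) P :=
    (integrable_const _).indicator₀ hAm
  have h_int := integral_mono (integrable_exp_mul_sum_range hindep hid n hηint)
    ((hindicator.add ((integrable_exp_mul_sum_range hindep hid n hpint).const_mul
      (Real.exp (-(n * (δ * (x + r))))))).add
      ((integrable_exp_mul_sum_range hindep hid n hmint).const_mul
        (Real.exp (n * (δ * (x - r)))))) hpoint
  rw [integral_add' (hindicator.add ((integrable_exp_mul_sum_range hindep hid n hpint).const_mul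
      _)) ((integrable_exp_mul_sum_range hindep hid n hmint).const_mul _),
    integral_add' hindicator ((integrable_exp_mul_sum_range hindep hid n hpint).const_mul _),
    integral_indicator₀ hAm, setIntegral_const, integral_const_mul, integral_const_mul,
    smul_eq_mul] at h_int
  change mgf S P η ≤ P.real A * _ + _ * mgf S P (η + δ) + _ * mgf S P (η - δ) at h_int
  rw [mgf_sum_range_eq_exp hindep hid n hηint, mgf_sum_range_eq_exp hindep hid n hpint,
    mgf_sum_range_eq_exp hindep hid n hmint, ← Real.exp_add, ← Real.exp_add] at h_int
  have hsmall : ∀ z : ℝ, z ≤ n * cgf W Q η - Real.log 4 →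
      Real.exp z ≤ Real.exp (n * cgf W Q η) / 4 := fun z hz => by
    refine (Real.exp_le_exp.2 hz).trans ?_
    rw [Real.exp_sub, Real.exp_log (by norm_num)]
  have hp := hsmall (-(n * (δ * (x + r))) + n * cgf W Q (η + δ)) (by nlinarith)
  have hm := hsmall (n * (δ * (x - r)) + n * cgf W Q (η - δ)) (by nlinarith)
  have hPA : Real.exp (n * cgf W Q η) / 2 ≤ P.real A * Real.exp (n * (η * x + gap / 2)) := by
    linarith
  rw [← ofReal_measureReal (μ := P)]
  refine ENNReal.ofReal_le_ofReal (le_trans ?_ (measureReal_mono hsub))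
  have h9 : Real.exp (-c * n) * Real.exp (n * (η * x + gap / 2)) ≤
      Real.exp (n * cgf W Q η) / 2 := by
    rw [← Real.exp_add, ← Real.exp_log (show (0 : ℝ) < 2 by norm_num), ← Real.exp_sub,
      Real.exp_log (by norm_num)]
    refine Real.exp_le_exp.2 ?_
    have : c = gap + (η * x - cgf W Q η) := by rw [hgap]; ring
    rw [this]
    linarith
  exact le_of_mul_le_mul_right (h9.trans hPA) (Real.exp_pos _)

/-- The function `η x - cgf η` is `0` at `0` and negative at `±a`, so its maximum over `[-a, a]` is
attained inside, where the derivative vanishes. -/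
theorem exists_deriv_cgf_eq {a x : ℝ} (ha : 0 ≤ a)
    (hsub : Set.Icc (-a) a ⊆ interior (integrableExpSet W Q))
    (hp : a * |x| < cgf W Q a) (hm : a * |x| < cgf W Q (-a)) :
    ∃ η ∈ interior (integrableExpSet W Q), deriv (cgf W Q) η = x := by
  have hcont : ContinuousOn (fun η => η * x - cgf W Q η) (Set.Icc (-a) a) :=
    (continuousOn_id.mul continuousOn_const).sub
      (analyticOnNhd_cgf.continuousOn.mono hsub)
  have h0 : (0 : ℝ) ∈ Set.Icc (-a) a := ⟨by linarith, ha⟩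
  obtain ⟨η, hη, hmax⟩ := isCompact_Icc.exists_isMaxOn ⟨0, h0⟩ hcont
  have h1 : 0 ≤ η * x - cgf W Q η := by simpa using hmax h0
  have hax := le_abs_self (a * x)
  have hax' := neg_abs_le (a * x)
  rw [abs_mul, abs_of_nonneg ha] at hax hax'
  have hne1 : η ≠ a := fun h => by rw [h] at h1; linarith
  have hne2 : η ≠ -a := fun h => by rw [h] at h1; linarith
  have hIoo : Set.Icc (-a) a ∈ nhds η :=
    Icc_mem_nhds (lt_of_le_of_ne hη.1 hne2.symm) (lt_of_le_of_ne hη.2 hne1)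
  refine ⟨η, hsub hη, ?_⟩
  have hd := (((hasDerivAt_id η).mul_const x).sub
    (analyticAt_cgf (hsub hη)).differentiableAt.hasDerivAt)
  have := (hmax.isLocalMax hIoo).hasDerivAt_eq_zero hd
  linarith

end IID

/-! ### The signed power and exponential moments of the two-sided exponential law. -/

theorem measurable_signedPow (p : ℝ) : Measurable (signedPow p) := by
  have hsign : Measurable Real.sign :=
    Measurable.ite measurableSet_Iio measurable_const
      (Measurable.ite measurableSet_Ioi measurable_const measurable_const)
  unfold signedPow
  fun_prop

theorem signedPow_neg (p x : ℝ) : signedPow p (-x) = -signedPow p x := by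
  simp [signedPow, Real.sign_neg]

theorem signedPow_of_nonneg {p x : ℝ} (hp : 0 < p) (hx : 0 ≤ x) : signedPow p x = x ^ p := by
  rcases hx.eq_or_lt with rfl | hx
  · simp [signedPow, Real.zero_rpow hp.ne']
  · simp [signedPow, Real.sign_of_pos hx, abs_of_pos hx]

theorem abs_signedPow {p : ℝ} (hp : 0 < p) (x : ℝ) : |signedPow p x| = |x| ^ p := by
  rcases le_total 0 x with hx | hx
  · rw [signedPow_of_nonneg hp hx, abs_of_nonneg (Real.rpow_nonneg hx p), abs_of_nonneg hx]
  · have hx' : 0 ≤ -x := neg_nonneg.2 hx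
    rw [← abs_neg, ← signedPow_neg, signedPow_of_nonneg hp hx',
      abs_of_nonneg (Real.rpow_nonneg hx' p), abs_of_nonpos hx]

theorem signedPow_one (x : ℝ) : signedPow 1 x = x := by
  rcases lt_trichotomy x 0 with h | h | h
  · simp [signedPow, Real.sign_of_neg h, abs_of_neg h]
  · simp [signedPow, h]
  · simp [signedPow, Real.sign_of_pos h, abs_of_pos h]

namespace twoSidedExponential

theorem measurable_density :
    Measurable fun y : ℝ => ENNReal.ofReal (Real.exp (-|y|) / 2) := by
  fun_prop

theorem measurePreserving_neg :
    MeasurePreserving (fun y : ℝ => -y) twoSidedExponential twoSidedExponential := by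
  refine ⟨measurable_neg, ?_⟩
  ext s hs
  rw [Measure.map_apply measurable_neg hs, twoSidedExponential,
    withDensity_apply _ (measurable_neg hs), withDensity_apply _ hs,
    ← lintegral_indicator (measurable_neg hs), ← lintegral_indicator hs,
    ← lintegral_neg_eq_self]
  refine lintegral_congr fun y => ?_
  have : -y ∈ Neg.neg ⁻¹' s ↔ y ∈ s := by simp
  by_cases hy : y ∈ s
  · rw [Set.indicator_of_mem hy, Set.indicator_of_mem (this.2 hy), abs_neg]
  · rw [Set.indicator_of_notMem hy, Set.indicator_of_notMem fun h => hy (this.1 h)]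

theorem integrable_iff {g : ℝ → ℝ} :
    Integrable g twoSidedExponential ↔ Integrable fun y => Real.exp (-|y|) / 2 * g y := by
  rw [twoSidedExponential,
    integrable_withDensity_iff_integrable_smul' measurable_density (by simp)]
  refine integrable_congr (ae_of_all _ fun y => ?_)
  simp [ENNReal.toReal_ofReal (show 0 ≤ Real.exp (-|y|) / 2 by positivity)]

theorem integral_eq (g : ℝ → ℝ) :
    ∫ y, g y ∂twoSidedExponential = ∫ y, Real.exp (-|y|) / 2 * g y := by
  rw [twoSidedExponential,
    integral_withDensity_eq_integral_toReal_smul measurable_density (by simp)]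
  refine integral_congr_ae (ae_of_all _ fun y => ?_)
  simp [ENNReal.toReal_ofReal (show 0 ≤ Real.exp (-|y|) / 2 by positivity)]

theorem integrable_exp_mul_abs {θ : ℝ} (hθ : θ < 1) :
    Integrable (fun y => Real.exp (θ * |y|)) twoSidedExponential := by
  rw [integrable_iff]
  have h1 : IntegrableOn (fun y : ℝ => Real.exp (-(1 - θ) * |y|)) (Set.Ioi 0) :=
    (integrableOn_exp_mul_Ioi (by linarith : -(1 - θ) < 0) 0).congr_fun
      (fun y hy => by rw [abs_of_pos hy]) measurableSet_Ioi
  have h2 : IntegrableOn (fun y : ℝ => Real.exp (-(1 - θ) * |y|)) (Set.Iic 0) :=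
    (integrableOn_exp_mul_Iic (by linarith : 0 < 1 - θ) 0).congr_fun
      (fun y hy => by dsimp only; rw [abs_of_nonpos hy, neg_mul_neg]) measurableSet_Iic
  have h3 : Integrable fun y : ℝ => Real.exp (-(1 - θ) * |y|) := by
    rw [← integrableOn_univ, ← Set.Iic_union_Ioi (a := (0 : ℝ))]
    exact h2.union h1
  refine (h3.div_const 2).congr (ae_of_all _ fun y => ?_)
  dsimp only
  rw [div_mul_eq_mul_div, ← Real.exp_add]
  ring_nf

theorem integrable_rpow_mul_exp {q θ : ℝ} (hq : 0 ≤ q) (hθ0 : 0 ≤ θ) (hθ : θ < 1) :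
    Integrable (fun y => |y| ^ q * Real.exp (θ * |y|)) twoSidedExponential := by
  have key : ∀ s : ℝ, |s| < 1 → Integrable (fun y => Real.exp (s * y)) twoSidedExponential := by
    intro s hs
    refine (integrable_exp_mul_abs hs).mono' (by fun_prop) (ae_of_all _ fun y => ?_)
    rw [Real.norm_eq_abs, Real.abs_exp, ← abs_mul]
    exact Real.exp_le_exp.2 (le_abs_self _)
  -- The midpoint of `θ` and `1` leaves room for the polynomial factor.
  have hm : |(θ + 1) / 2| = (θ + 1) / 2 := abs_of_pos (by linarith)
  simpa using integrable_rpow_abs_mul_exp_add_of_integrable_exp_mul (X := fun y : ℝ => y)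
    (μ := twoSidedExponential) (v := 0) (t := (θ + 1) / 2) (x := θ)
    (key _ (by rw [zero_add, hm]; linarith)) (key _ (by rw [zero_sub, abs_neg, hm]; linarith))
    hθ0 (by rw [hm]; linarith) hq

/-- The density is smallest at the right endpoint. Only a constant factor is lost against `e^{-y}`,
which is invisible at speed `n^{1/p}`. -/
theorem le_measure_Icc {y : ℝ} (hy : 0 ≤ y) :
    ENNReal.ofReal (Real.exp (-(y + 1)) / 2) ≤ twoSidedExponential (Set.Icc y (y + 1)) := by
  rw [twoSidedExponential, withDensity_apply _ measurableSet_Icc]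
  calc ENNReal.ofReal (Real.exp (-(y + 1)) / 2)
      = ∫⁻ _ in Set.Icc y (y + 1), ENNReal.ofReal (Real.exp (-(y + 1)) / 2) := by
        simp [Real.volume_Icc]
    _ ≤ _ := by
        refine setLIntegral_mono measurable_density fun z hz => ?_
        gcongr
        rw [abs_of_nonneg (hy.trans hz.1)]
        exact hz.2

/-- The integral of an odd function vanishes. -/
theorem integral_eq_zero_of_odd {g : ℝ → ℝ} (hg : ∀ y, g (-y) = -g y) :
    ∫ y, g y ∂twoSidedExponential = 0 := by
  have h := measurePreserving_neg.integral_comp (MeasurableEquiv.neg ℝ).measurableEmbedding g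
  simp only [hg, integral_neg] at h
  linarith

theorem identDistrib_neg {g : ℝ → ℝ} (hgm : Measurable g) (hg : ∀ y, g (-y) = -g y) :
    IdentDistrib g (fun y => -g y) twoSidedExponential twoSidedExponential := by
  refine ⟨hgm.aemeasurable, hgm.neg.aemeasurable, ?_⟩
  have : (fun y => -g y) = g ∘ fun y => -y := funext fun y => (hg y).symm
  rw [this, ← Measure.map_map hgm measurable_neg, measurePreserving_neg.map_eq]

/-- For `p < 1` all exponential moments are finite. -/
theorem integrable_exp_mul_signedPow_of_lt_one {p : ℝ} (hp : 0 < p) (hp1 : p < 1) (t : ℝ) :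
    Integrable (fun y => Real.exp (t * signedPow p y)) twoSidedExponential := by
  -- With `K^{1-p} = L`, weighted AM-GM gives `L |y|^p ≤ |y| + K`, hence `|t| |y|^p ≤ (|y| + K) /
  -- 2`, and `e^{|y|/2}` is integrable.
  set L := 2 * |t| + 1 with hL
  have hL0 : 0 < L := by positivity
  set K := L ^ (1 / (1 - p)) with hK
  have hK0 : 0 < K := Real.rpow_pos_of_pos hL0 _
  have hKL : K ^ (1 - p) = L := by
    rw [hK, ← Real.rpow_mul hL0.le, one_div_mul_cancel (by linarith), Real.rpow_one]
  refine ((integrable_exp_mul_abs (θ := 1 / 2) (by norm_num)).const_mul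
    (Real.exp (K / 2))).mono' ?_ (ae_of_all _ fun y => ?_)
  · exact (Real.measurable_exp.comp
      ((measurable_signedPow p).const_mul t)).aestronglyMeasurable
  rw [Real.norm_eq_abs, Real.abs_exp, ← Real.exp_add]
  refine Real.exp_le_exp.2 ?_
  have h1 : t * signedPow p y ≤ |t| * |y| ^ p := by
    rw [← abs_signedPow hp, ← abs_mul]; exact le_abs_self _
  have h2 := Real.geom_mean_le_arith_mean2_weighted hp.le (by linarith : 0 ≤ 1 - p)
    (abs_nonneg y) hK0.le (by ring)
  rw [hKL] at h2
  have h3 : 0 ≤ |y| ^ p := by positivity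
  have h4 : p * |y| + (1 - p) * K ≤ |y| + K := by nlinarith [abs_nonneg y]
  nlinarith

theorem integrable_exp_mul_signedPow_one {t : ℝ} (ht : |t| < 1) :
    Integrable (fun y => Real.exp (t * signedPow 1 y)) twoSidedExponential := by
  simp_rw [signedPow_one]
  refine (integrable_exp_mul_abs ht).mono' (by fun_prop) (ae_of_all _ fun y => ?_)
  rw [Real.norm_eq_abs, Real.abs_exp, ← abs_mul]
  exact Real.exp_le_exp.2 (le_abs_self _)

/-- The left side is the contribution of `y > 0`. Its blow-up as `t → 1` makes every real number a
slope when `p = 1`. -/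
theorem inv_two_mul_one_sub_le_mgf_signedPow_one {t : ℝ} (ht : |t| < 1) :
    (2 * (1 - t))⁻¹ ≤ mgf (signedPow 1) twoSidedExponential t := by
  have h_int := integrable_exp_mul_signedPow_one ht
  rw [integrable_iff] at h_int
  have ht1 := (abs_lt.1 ht).2
  rw [mgf, integral_eq]
  calc (2 * (1 - t))⁻¹ = ∫ y in Set.Ioi (0 : ℝ), Real.exp (-(1 - t) * y) / 2 := by
        rw [integral_div, integral_exp_mul_Ioi (by linarith)]
        have : 1 - t ≠ 0 := by linarith
        simp only [mul_zero, Real.exp_zero]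
        field_simp
    _ = ∫ y in Set.Ioi (0 : ℝ), Real.exp (-|y|) / 2 * Real.exp (t * signedPow 1 y) := by
        refine setIntegral_congr_fun measurableSet_Ioi fun y hy => ?_
        simp only [signedPow_one]
        rw [abs_of_pos hy, div_mul_eq_mul_div, ← Real.exp_add]
        ring_nf
    _ ≤ _ := setIntegral_le_integral h_int (ae_of_all _ fun y => by positivity)

end twoSidedExponential

/-! ### Cramér's theorem for symmetric variables. -/

section Cramer

variable {Ω Ω' : Type*} [MeasurableSpace Ω] [MeasurableSpace Ω'] {P : Measure Ω} {Q : Measure Ω'}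
  {X : ℕ → Ω → ℝ} {W : Ω' → ℝ}

theorem lowerSemicontinuous_legendre (L : ℝ → EReal) : LowerSemicontinuous (legendre L) := by
  refine lowerSemicontinuous_iSup fun η => Continuous.lowerSemicontinuous ?_
  induction L η with
  | bot =>
    simp only [sub_eq_add_neg, EReal.neg_bot, EReal.coe_add_top]
    exact continuous_const
  | top => simp [continuous_const]
  | coe l =>
    simp_rw [← EReal.coe_sub]
    exact continuous_coe_real_ereal.comp (by fun_prop)

theorem freeEnergy_eq_top (hW : AEMeasurable W Q) {t : ℝ}
    (ht : ¬ Integrable (fun ω => Real.exp (t * W ω)) Q) : freeEnergy Q W t = ⊤ := by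
  rw [freeEnergy, ENNReal.log_eq_top_iff]
  by_contra h
  refine ht ((lintegral_ofReal_ne_top_iff_integrable ?_ (ae_of_all _ fun _ =>
    Real.exp_nonneg _)).1 h)
  exact (Real.measurable_exp.comp_aemeasurable (hW.const_mul t)).aestronglyMeasurable

theorem integrable_exp_neg_mul_of_symmetric (hsymm : IdentDistrib W (fun ω => -W ω) Q Q) {t : ℝ}
    (ht : Integrable (fun ω => Real.exp (t * W ω)) Q) :
    Integrable (fun ω => Real.exp (-t * W ω)) Q := by
  have h := (hsymm.comp (u := fun x => Real.exp (t * x)) (by fun_prop)).integrable_snd ht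
  simpa [Function.comp_def] using h

theorem cgf_neg_of_symmetric (hsymm : IdentDistrib W (fun ω => -W ω) Q Q) (t : ℝ) :
    cgf W Q (-t) = cgf W Q t := by
  have h := congrFun (mgf_congr_identDistrib hsymm) (-t)
  rw [cgf, cgf, h]
  simp [mgf]

variable [IsProbabilityMeasure Q]

theorem freeEnergy_eq_cgf {t : ℝ} (ht : Integrable (fun ω => Real.exp (t * W ω)) Q) :
    freeEnergy Q W t = cgf W Q t := by
  rw [freeEnergy, ← ofReal_integral_eq_lintegral_ofReal ht (ae_of_all _ fun _ => Real.exp_nonneg _)]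
  exact ENNReal.log_ofReal_of_pos (mgf_pos ht)

/-- Where the exponential is not integrable, the free energy is `⊤` and its term in the supremum is
`⊥`; the real `cgf` has a junk value there, so integrability is carried along. -/
theorem lt_legendre_freeEnergy_iff (hW : AEMeasurable W Q) {c x : ℝ} :
    (c : EReal) < legendre (freeEnergy Q W) x ↔
      ∃ t : ℝ, Integrable (fun ω => Real.exp (t * W ω)) Q ∧ c < t * x - cgf W Q t := by
  rw [legendre, lt_iSup_iff]
  refine exists_congr fun t => ?_
  by_cases ht : Integrable (fun ω => Real.exp (t * W ω)) Q
  · rw [freeEnergy_eq_cgf ht, ← EReal.coe_sub, EReal.coe_lt_coe_iff]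
    simp [ht]
  · simp [freeEnergy_eq_top hW ht, ht]

/-- By symmetry twice the moment generating function is the expectation of `e^u + e^{-u} ≥ 2`, with
`u = t W`. -/
theorem cgf_nonneg_of_symmetric (hsymm : IdentDistrib W (fun ω => -W ω) Q Q) {t : ℝ}
    (ht : Integrable (fun ω => Real.exp (t * W ω)) Q) : 0 ≤ cgf W Q t := by
  have ht' := integrable_exp_neg_mul_of_symmetric hsymm ht
  refine Real.log_nonneg ?_
  have h1 : mgf W Q (-t) = mgf W Q t := by
    have h := congrFun (mgf_congr_identDistrib hsymm) (-t)
    rw [h]; simp [mgf]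
  have h2 : ∫ _, (2 : ℝ) ∂Q ≤ mgf W Q t + mgf W Q (-t) := by
    rw [mgf, mgf, ← integral_add ht ht']
    refine integral_mono (integrable_const _) (ht.add ht') fun ω => ?_
    have h3 := Real.add_one_le_exp (t * W ω)
    have h4 := Real.add_one_le_exp (-t * W ω)
    dsimp only [Pi.add_apply]
    linarith
  rw [h1] at h2
  simp only [integral_const, probReal_univ, smul_eq_mul, one_mul] at h2
  linarith

variable [IsProbabilityMeasure P]

theorem eventually_measure_le_empiricalMean_le (hindep : iIndepFun X P)
    (hid : ∀ i, IdentDistrib (X i) W P Q) (hsymm : IdentDistrib W (fun ω => -W ω) Q Q)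
    {b c t : ℝ} (hb : 0 < b) (hc : 0 ≤ c) (ht : Integrable (fun ω => Real.exp (t * W ω)) Q)
    (hct : c < t * b - cgf W Q t) :
    ∀ᶠ n : ℕ in atTop, P {ω | b ≤ empiricalMean X n ω} ≤ ENNReal.ofReal (Real.exp (-c * n)) := by
  have hcgf := cgf_nonneg_of_symmetric hsymm ht
  -- Chernoff's bound on the right tail needs `0 ≤ t`; this is automatic, since `t * b > c + cgf W Q
  -- t ≥ 0`.
  have ht0 : 0 ≤ t := by
    by_contra! h
    nlinarith
  filter_upwards [eventually_gt_atTop 0] with n hn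
  refine (measure_le_empiricalMean_le hindep hid ht0 ht b hn).trans
    (ENNReal.ofReal_le_ofReal (Real.exp_le_exp.2 ?_))
  gcongr

/-- Cramér's theorem for symmetric variables whose cumulant generating function has every real
number as a slope. -/
theorem satisfiesLDP_empiricalMean_of_symmetric (hindep : iIndepFun X P)
    (hid : ∀ i, IdentDistrib (X i) W P Q) (hsymm : IdentDistrib W (fun ω => -W ω) Q Q)
    (hsteep : ∀ x, ∃ t ∈ interior (integrableExpSet W Q), deriv (cgf W Q) t = x) :
    SatisfiesLDP P (empiricalMean X) (fun n => (n : ℝ)) (legendre (freeEnergy Q W)) := by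
  have hW := hsymm.aemeasurable_fst
  have hnonneg : ∀ x, 0 ≤ legendre (freeEnergy Q W) x := fun x => by
    refine le_trans ?_ (le_iSup _ (0 : ℝ))
    simp [freeEnergy]
  refine SatisfiesLDP.of_halfLines tendsto_natCast_atTop_atTop hnonneg
    (lowerSemicontinuous_legendre _) ?_ ?_ ?_ ?_
  · refine le_antisymm ?_ (hnonneg 0)
    by_contra! h
    obtain ⟨t, ht, h1⟩ := (lt_legendre_freeEnergy_iff hW (c := 0)).1 (by simpa using h)
    have := cgf_nonneg_of_symmetric hsymm ht
    linarith
  · intro b hb c hc h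
    obtain ⟨t, ht, h1⟩ := (lt_legendre_freeEnergy_iff hW).1 h
    exact eventually_measure_le_empiricalMean_le hindep hid hsymm hb hc ht h1
  · intro a ha c hc h
    obtain ⟨t, ht, h1⟩ := (lt_legendre_freeEnergy_iff hW).1 h
    have h2 := eventually_measure_le_empiricalMean_le (X := fun i ω => -X i ω) (b := -a)
      (hindep.comp (fun _ x => -x) fun _ => measurable_neg)
      (fun i => ((hid i).comp measurable_neg).trans hsymm.symm) hsymm (neg_pos.2 ha) hc
      (integrable_exp_neg_mul_of_symmetric hsymm ht)
      (by rwa [cgf_neg_of_symmetric hsymm, neg_mul_neg])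
    simpa only [empiricalMean_neg, neg_le_neg_iff] using h2
  · intro x ε hε c hc
    obtain ⟨t, ht, hx⟩ := hsteep x
    refine eventually_le_measure_empiricalMean_near hindep hid ht hx hε ?_
    by_contra! h
    refine absurd hc (not_lt.2 ((EReal.coe_le_coe_iff.2 h).trans ?_))
    rw [EReal.coe_sub, ← freeEnergy_eq_cgf (W := W) (Q := Q) (t := t) (interior_subset ht :)]
    exact le_iSup (fun η : ℝ => ((η * x : ℝ) : EReal) - freeEnergy Q W η) t

end Cramer

/-! ### Every real number is a slope when `0 < p ≤ 1`. -/

namespace twoSidedExponential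

theorem exists_deriv_cgf_signedPow_eq [IsProbabilityMeasure twoSidedExponential] {p : ℝ}
    (hp : 0 < p) (hp1 : p ≤ 1) (x : ℝ) :
    ∃ t ∈ interior (integrableExpSet (signedPow p) twoSidedExponential),
      deriv (cgf (signedPow p) twoSidedExponential) t = x := by
  have hsymm := identDistrib_neg (measurable_signedPow p) (signedPow_neg p)
  rcases hp1.eq_or_lt with rfl | hp1
  · have hsub : Set.Ioo (-1) 1 ⊆ interior (integrableExpSet (signedPow 1) twoSidedExponential) :=
      interior_maximal (fun t ht => integrable_exp_mul_signedPow_one (abs_lt.2 ht)) isOpen_Ioo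
    -- Chosen so that `(2 * (1 - a))⁻¹ = e^{|x| + 1}`, whence `cgf a ≥ |x| + 1 > a |x|`.
    set a := 1 - Real.exp (-(|x| + 1)) / 2 with ha
    have hexp : Real.exp (-(|x| + 1)) < 1 :=
      Real.exp_lt_one_iff.2 (by have := abs_nonneg x; linarith)
    have hexp0 := Real.exp_pos (-(|x| + 1))
    have ha0 : 0 ≤ a := by linarith
    have ha1 : a < 1 := by linarith
    have hmgf := inv_two_mul_one_sub_le_mgf_signedPow_one (t := a) (by rwa [abs_of_nonneg ha0])
    have h1 : a * |x| < cgf (signedPow 1) twoSidedExponential a := by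
      have h2 : (2 * (1 - a))⁻¹ = Real.exp (|x| + 1) := by
        rw [ha, Real.exp_neg]
        field_simp
        ring
      rw [h2] at hmgf
      have h3 := Real.log_le_log (Real.exp_pos _) hmgf
      rw [Real.log_exp] at h3
      have : a * |x| ≤ 1 * |x| := by gcongr
      rw [cgf]
      linarith
    refine exists_deriv_cgf_eq ha0 ((Set.Icc_subset_Ioo (by linarith) ha1).trans hsub) h1 ?_
    rwa [cgf_neg_of_symmetric hsymm]
  · have h_int := integrable_exp_mul_signedPow_of_lt_one hp hp1
    have huniv : integrableExpSet (signedPow p) twoSidedExponential = Set.univ :=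
      Set.eq_univ_of_forall h_int
    set R := |x| + 1 with hR
    have hR0 : 0 < R := by positivity
    have hy0 : 0 ≤ R ^ (1 / p) := by positivity
    set q := Real.exp (-(R ^ (1 / p) + 1)) / 2 with hq
    have hq0 : 0 < q := by positivity
    have htail : q ≤ twoSidedExponential.real {y | R ≤ signedPow p y} := by
      rw [Measure.real, ← ENNReal.ofReal_le_iff_le_toReal (measure_ne_top _ _)]
      refine (le_measure_Icc hy0).trans (measure_mono fun y hy => ?_)
      have h1 : 0 ≤ y := hy0.trans hy.1
      change R ≤ signedPow p y
      rw [signedPow_of_nonneg hp h1]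
      calc R = (R ^ (1 / p)) ^ p := by
            rw [← Real.rpow_mul hR0.le, one_div_mul_cancel hp.ne', Real.rpow_one]
        _ ≤ y ^ p := Real.rpow_le_rpow hy0 hy.1 hp.le
    -- Chernoff's inequality read backwards gives `cgf a ≥ a R + log q = a |x| + (a + log q)`, and
    -- this `a` makes the bracket positive.
    set a := |Real.log q| + 1 with ha
    have ha0 : 0 ≤ a := by positivity
    have h1 : a * |x| < cgf (signedPow p) twoSidedExponential a := by
      have h2 := htail.trans (measure_ge_le_exp_cgf R ha0 (h_int a))
      have h3 := Real.log_le_log hq0 h2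
      rw [Real.log_exp] at h3
      have h4 := neg_abs_le (Real.log q)
      rw [hR] at h3
      linarith
    refine exists_deriv_cgf_eq ha0 (by simp [huniv]) h1 ?_
    rwa [cgf_neg_of_symmetric hsymm]

end twoSidedExponential

/-! ### Truncation and the upper tail for `p > 1`. -/

theorem Real.exp_le_one_add_add_sq_mul_exp_abs (u : ℝ) :
    Real.exp u ≤ 1 + u + u ^ 2 * Real.exp |u| := by
  have h := Complex.norm_exp_sub_sum_le_norm_mul_exp (u : ℂ) 2
  simp only [Finset.sum_range_succ, Finset.range_zero, Finset.sum_empty, Complex.norm_real,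
    Real.norm_eq_abs, pow_zero, pow_one, Nat.factorial, sq_abs] at h
  norm_num at h
  rw [← Complex.ofReal_exp, ← Complex.ofReal_one, ← Complex.ofReal_add, ← Complex.ofReal_sub,
    Complex.norm_real, Real.norm_eq_abs] at h
  linarith [le_abs_self (Real.exp u - (1 + u))]

/-- The truncation of `x` at level `T`, which vanishes where `|x| > T`. -/
noncomputable def truncateAt (T x : ℝ) : ℝ := if |x| ≤ T then x else 0

theorem measurable_truncateAt (T : ℝ) : Measurable (truncateAt T) :=
  Measurable.ite (measurableSet_le measurable_norm measurable_const) measurable_id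
    measurable_const

theorem abs_truncateAt_le (T x : ℝ) : |truncateAt T x| ≤ |x| := by
  unfold truncateAt
  split_ifs <;> simp

theorem truncateAt_neg (T x : ℝ) : truncateAt T (-x) = -truncateAt T x := by
  unfold truncateAt
  rw [abs_neg]
  split_ifs <;> simp

namespace twoSidedExponential

variable {p : ℝ}

theorem integrable_signedPow_sq (hp : 0 < p) :
    Integrable (fun y => signedPow p y ^ 2) twoSidedExponential := by
  have h := integrable_rpow_mul_exp (q := 2 * p) (θ := 0) (by positivity) le_rfl one_pos
  refine h.congr (ae_of_all _ fun y => ?_)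
  simp only [zero_mul, Real.exp_zero, mul_one]
  rw [← sq_abs (signedPow p y), abs_signedPow hp, mul_comm, Real.rpow_mul (abs_nonneg y),
    Real.rpow_two]

theorem memLp_two_signedPow (hp : 0 < p) : MemLp (signedPow p) 2 twoSidedExponential :=
  (memLp_two_iff_integrable_sq (measurable_signedPow p).aestronglyMeasurable).2
    (integrable_signedPow_sq hp)

/-- As `1/p - 1 < 0`, `|x| ≤ T` implies `T^{1/p-1} |x| ≤ |x|^{1/p}`, which is `|y|` for `x =
signedPow p y`. So this tilt grants exponential moments uniformly in `T`. -/
theorem abs_mul_truncateAt_signedPow_le (hp : 1 < p) {θ T : ℝ} (hθ : 0 ≤ θ) (hT : 0 < T)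
    (y : ℝ) : |θ * T ^ (1 / p - 1) * truncateAt T (signedPow p y)| ≤ θ * |y| := by
  have hp0 : 0 < p := by linarith
  unfold truncateAt
  split_ifs with h
  · rw [abs_signedPow hp0] at h
    rw [abs_mul, abs_signedPow hp0, abs_of_nonneg (by positivity), mul_assoc]
    refine mul_le_mul_of_nonneg_left ?_ hθ
    rcases (abs_nonneg y).eq_or_lt with hy | hy
    · rw [← hy, Real.zero_rpow hp0.ne', mul_zero]
    have h1 : |y| ^ (p - 1) ≤ T ^ (1 - 1 / p) := by
      have h2 := Real.rpow_le_rpow (by positivity) h (show 0 ≤ 1 - 1 / p by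
        rw [sub_nonneg, div_le_one hp0]; exact hp.le)
      rwa [← Real.rpow_mul hy.le, mul_sub, mul_one, mul_one_div_cancel hp0.ne'] at h2
    calc T ^ (1 / p - 1) * |y| ^ p = T ^ (1 / p - 1) * |y| ^ (p - 1) * |y| := by
          rw [mul_assoc, Real.rpow_sub_one hy.ne', div_mul_cancel₀ _ hy.ne']
      _ ≤ T ^ (1 / p - 1) * T ^ (1 - 1 / p) * |y| := by gcongr
      _ = |y| := by rw [← Real.rpow_add hT]; simp
  · simpa using by positivity

theorem integrable_exp_mul_truncateAt_signedPow (hp : 1 < p) {θ T : ℝ} (hθ : 0 ≤ θ)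
    (hθ1 : θ < 1) (hT : 0 < T) :
    Integrable (fun y => Real.exp (θ * T ^ (1 / p - 1) * truncateAt T (signedPow p y)))
      twoSidedExponential := by
  refine (integrable_exp_mul_abs hθ1).mono' ?_ (ae_of_all _ fun y => ?_)
  · exact (Real.measurable_exp.comp (((measurable_truncateAt T).comp
      (measurable_signedPow p)).const_mul _)).aestronglyMeasurable
  · rw [Real.norm_eq_abs, Real.abs_exp]
    exact Real.exp_le_exp.2
      ((le_abs_self _).trans (abs_mul_truncateAt_signedPow_le hp hθ hT y))

variable [IsProbabilityMeasure twoSidedExponential]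

/-- The truncated variable is odd in `y`, so the linear Taylor term integrates to zero; the constant
in the quadratic term does not depend on `T`. -/
theorem cgf_truncateAt_signedPow_le (hp : 1 < p) {θ T : ℝ} (hθ : 0 ≤ θ) (hθ1 : θ < 1)
    (hT : 0 < T) :
    cgf (fun y => truncateAt T (signedPow p y)) twoSidedExponential (θ * T ^ (1 / p - 1)) ≤
      (∫ y, |y| ^ (2 * p) * Real.exp (θ * |y|) ∂twoSidedExponential) *
        (θ * T ^ (1 / p - 1)) ^ 2 := by
  have hp0 : 0 < p := by linarith
  set s := θ * T ^ (1 / p - 1) with hs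
  set g : ℝ → ℝ := fun y => truncateAt T (signedPow p y) with hg
  have hgm : Measurable g := (measurable_truncateAt T).comp (measurable_signedPow p)
  have hbound : ∀ y, |s * g y| ≤ θ * |y| := abs_mul_truncateAt_signedPow_le hp hθ hT
  have hexp := integrable_exp_mul_truncateAt_signedPow hp hθ hθ1 hT
  have hmom := integrable_rpow_mul_exp (q := 2 * p) (by positivity) hθ hθ1
  have hgint : Integrable g twoSidedExponential := by
    have h := (memLp_two_signedPow hp0).integrable (by norm_num)
    refine h.mono hgm.aestronglyMeasurable (ae_of_all _ fun y => ?_)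
    exact abs_truncateAt_le T _
  have hodd : ∫ y, g y ∂twoSidedExponential = 0 :=
    integral_eq_zero_of_odd fun y => by
      simp only [hg, signedPow_neg, truncateAt_neg]
  have hpoint : ∀ y, Real.exp (s * g y) ≤
      1 + s * g y + s ^ 2 * (|y| ^ (2 * p) * Real.exp (θ * |y|)) := by
    intro y
    refine (Real.exp_le_one_add_add_sq_mul_exp_abs _).trans ?_
    rw [mul_pow, mul_assoc (s ^ 2)]
    gcongr
    · rw [mul_comm 2 p, Real.rpow_mul (abs_nonneg y), Real.rpow_two, ← abs_signedPow hp0,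
        ← sq_abs (g y)]
      exact pow_le_pow_left₀ (abs_nonneg _) (abs_truncateAt_le T _) 2
    · exact hbound y
  have hmgf : mgf g twoSidedExponential s ≤
      1 + s ^ 2 * ∫ y, |y| ^ (2 * p) * Real.exp (θ * |y|) ∂twoSidedExponential := by
    have h1 : Integrable (fun y => 1 + s * g y) twoSidedExponential :=
      (integrable_const _).add (hgint.const_mul s)
    refine (integral_mono hexp (h1.add (hmom.const_mul (s ^ 2))) hpoint).trans (le_of_eq ?_)
    rw [integral_add' h1 (hmom.const_mul (s ^ 2)),
      integral_add (integrable_const _) (hgint.const_mul s), integral_const_mul,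
      integral_const_mul, hodd]
    simp
  rw [cgf, mul_comm]
  have := Real.log_le_sub_one_of_pos (mgf_pos hexp)
  linarith

theorem measure_lt_abs_signedPow_le (hp : 0 < p) {θ T : ℝ} (hθ : 0 ≤ θ) (hθ1 : θ < 1)
    (hT : 0 < T) :
    twoSidedExponential {y | T < |signedPow p y|} ≤
      ENNReal.ofReal ((∫ y, Real.exp (θ * |y|) ∂twoSidedExponential) *
        Real.exp (-θ * T ^ (1 / p))) := by
  have h := measure_ge_le_exp_mul_mgf (X := fun y : ℝ => |y|) (μ := twoSidedExponential)
    (T ^ (1 / p)) hθ (integrable_exp_mul_abs hθ1)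
  rw [mul_comm] at h
  refine le_trans ?_ (ENNReal.ofReal_le_ofReal h)
  rw [ofReal_measureReal]
  refine measure_mono fun y hy => ?_
  have hy' : T < |y| ^ p := by rw [← abs_signedPow hp]; exact hy
  change T ^ (1 / p) ≤ |y|
  calc T ^ (1 / p) ≤ (|y| ^ p) ^ (1 / p) := by gcongr
    _ = |y| := by rw [← Real.rpow_mul (abs_nonneg y), mul_one_div_cancel hp.ne', Real.rpow_one]

variable {Ω : Type*} [MeasurableSpace Ω] {P : Measure Ω} [IsProbabilityMeasure P]
  {X : ℕ → Ω → ℝ}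

/-- Truncation at `T = n b` changes nothing unless some summand exceeds `T`. The first term in the
bracket comes from Chernoff's bound for truncated variables, the second from a union bound over
large summands. -/
theorem measure_le_empiricalMean_le (hp : 1 < p) (hindep : iIndepFun X P)
    (hid : ∀ i, IdentDistrib (X i) (signedPow p) P twoSidedExponential) {θ b : ℝ}
    (hθ : 0 ≤ θ) (hθ1 : θ < 1) (hb : 0 < b) {n : ℕ} (hn : 0 < n) :
    P {ω | b ≤ empiricalMean X n ω} ≤ ENNReal.ofReal (Real.exp (-θ * (n * b) ^ (1 / p)) *
      (Real.exp ((∫ y, |y| ^ (2 * p) * Real.exp (θ * |y|) ∂twoSidedExponential) *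
        (θ * (n * b) ^ (1 / p - 1)) ^ 2 * n) +
      n * ∫ y, Real.exp (θ * |y|) ∂twoSidedExponential)) := by
  have hp0 : 0 < p := by linarith
  have hn' : (0 : ℝ) < n := by exact_mod_cast hn
  set T : ℝ := n * b with hT
  have hT0 : 0 < T := by positivity
  set s := θ * T ^ (1 / p - 1) with hs
  set C := ∫ y, |y| ^ (2 * p) * Real.exp (θ * |y|) ∂twoSidedExponential with hC
  set D := ∫ y, Real.exp (θ * |y|) ∂twoSidedExponential with hD
  have hD0 : 0 ≤ D := integral_nonneg fun y => Real.exp_nonneg _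
  have hsub : {ω | b ≤ empiricalMean X n ω} ⊆
      {ω | b ≤ empiricalMean (fun i ω => truncateAt T (X i ω)) n ω} ∪
        ⋃ i ∈ Finset.range n, {ω | T < |X i ω|} := by
    intro ω hω
    by_cases h : ∃ i ∈ Finset.range n, T < |X i ω|
    · obtain ⟨i, hi, h⟩ := h
      exact Or.inr (Set.mem_biUnion hi h)
    · push Not at h
      left
      have : empiricalMean (fun i ω => truncateAt T (X i ω)) n ω = empiricalMean X n ω := by
        unfold empiricalMean
        congr 1
        exact Finset.sum_congr rfl fun i hi => if_pos (h i hi)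
      change b ≤ _
      rw [this]
      exact hω
  have h1 : P {ω | b ≤ empiricalMean (fun i ω => truncateAt T (X i ω)) n ω} ≤
      ENNReal.ofReal (Real.exp (-θ * T ^ (1 / p)) * Real.exp (C * s ^ 2 * n)) := by
    refine (_root_.measure_le_empiricalMean_le (X := fun i ω => truncateAt T (X i ω))
      (W := fun y => truncateAt T (signedPow p y)) (Q := twoSidedExponential) (t := s)
      (hindep.comp (fun _ => truncateAt T) fun _ => measurable_truncateAt T)
      (fun i => (hid i).comp (measurable_truncateAt T)) (by positivity)
      (integrable_exp_mul_truncateAt_signedPow hp hθ hθ1 hT0) b hn).trans ?_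
    rw [← Real.exp_add]
    refine ENNReal.ofReal_le_ofReal (Real.exp_le_exp.2 ?_)
    have h2 := cgf_truncateAt_signedPow_le hp hθ hθ1 hT0
    have h3 : s * b * n = θ * T ^ (1 / p) := by
      rw [hs, Real.rpow_sub_one hT0.ne']
      field_simp
      rw [hT]
      ring
    have h4 := mul_le_mul_of_nonneg_right h2 hn'.le
    linarith
  have h2 : P (⋃ i ∈ Finset.range n, {ω | T < |X i ω|}) ≤
      ENNReal.ofReal (n * (D * Real.exp (-θ * T ^ (1 / p)))) := by
    refine (measure_biUnion_finset_le _ _).trans ?_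
    have h3 : ∀ i ∈ Finset.range n, P {ω | T < |X i ω|} ≤
        ENNReal.ofReal (D * Real.exp (-θ * T ^ (1 / p))) := fun i _ => by
      have h4 := (hid i).measure_mem_eq (s := {x | T < |x|})
        (measurableSet_lt measurable_const measurable_norm)
      exact h4.trans_le (measure_lt_abs_signedPow_le hp0 hθ hθ1 hT0)
    refine (Finset.sum_le_sum h3).trans (le_of_eq ?_)
    rw [Finset.sum_const, Finset.card_range, nsmul_eq_mul, ENNReal.ofReal_mul hn'.le,
      ENNReal.ofReal_natCast]
  refine (measure_mono hsub).trans ((measure_union_le _ _).trans ((add_le_add h1 h2).trans ?_))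
  rw [← ENNReal.ofReal_add (by positivity) (by positivity)]
  exact ENNReal.ofReal_le_ofReal (le_of_eq (by ring))

end twoSidedExponential

/-! ### The principle at speed `n^{1/p}` for `p > 1`. -/

namespace twoSidedExponential

variable {p : ℝ} {Ω : Type*} [MeasurableSpace Ω] {P : Measure Ω} [IsProbabilityMeasure P]
  {X : ℕ → Ω → ℝ}

theorem tendsto_natCast_rpow_one_div (hp : 0 < p) :
    Tendsto (fun n : ℕ => (n : ℝ) ^ (1 / p)) atTop atTop :=
  (tendsto_rpow_atTop (by positivity)).comp tendsto_natCast_atTop_atTop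

/-- Chebyshev's inequality: the variance is at most `n V`, against `(n r)^2`. Index `0` is left out
to serve as the jump. -/
theorem eventually_half_le_measure_abs_sum_erase_lt (hp : 0 < p) (hindep : iIndepFun X P)
    (hid : ∀ i, IdentDistrib (X i) (signedPow p) P twoSidedExponential) {r : ℝ} (hr : 0 < r) :
    ∀ᶠ n : ℕ in atTop,
      1 / 2 ≤ P {ω | |(∑ i ∈ (Finset.range n).erase 0, X i) ω| < n * r} := by
  set V := variance (signedPow p) twoSidedExponential with hV
  have hV0 : 0 ≤ V := variance_nonneg _ _
  have hmem : ∀ i, MemLp (X i) 2 P := fun i => (hid i).symm.memLp_snd (memLp_two_signedPow hp)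
  have hzero : ∀ i, ∫ ω, X i ω ∂P = 0 := fun i =>
    (hid i).integral_eq.trans (integral_eq_zero_of_odd (signedPow_neg p))
  have hlim : Tendsto (fun n : ℕ => r ^ 2 * (n : ℝ)) atTop atTop :=
    tendsto_natCast_atTop_atTop.const_mul_atTop (by positivity)
  filter_upwards [eventually_gt_atTop 0, hlim.eventually_ge_atTop (2 * V)] with n hn hnV
  have hn' : (0 : ℝ) < n := by exact_mod_cast hn
  set S : Ω → ℝ := ∑ i ∈ (Finset.range n).erase 0, X i with hS
  have hSmem : MemLp S 2 P := memLp_finsetSum' _ fun i _ => hmem i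
  have hSzero : ∫ ω, S ω ∂P = 0 := by
    simp only [hS, Finset.sum_apply]
    rw [integral_finsetSum _ fun i _ => (hmem i).integrable (by norm_num)]
    exact Finset.sum_eq_zero fun i _ => hzero i
  have hSvar : variance S P ≤ n * V := by
    rw [hS, IndepFun.variance_sum (fun i _ => hmem i) fun i _ j _ hij => hindep.indepFun hij,
      Finset.sum_congr rfl fun i _ => (hid i).variance_eq, Finset.sum_const, nsmul_eq_mul]
    gcongr
    exact (Finset.card_le_card (Finset.erase_subset _ _)).trans_eq (Finset.card_range n)
  have hcheb := meas_ge_le_variance_div_sq hSmem (c := n * r) (by positivity)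
  simp only [hSzero, sub_zero] at hcheb
  have hhalf : P {ω | n * r ≤ |S ω|} ≤ 1 / 2 := by
    refine hcheb.trans ?_
    rw [show (1 / 2 : ℝ≥0∞) = ENNReal.ofReal (1 / 2) by
      rw [ENNReal.ofReal_div_of_pos two_pos]; simp]
    refine ENNReal.ofReal_le_ofReal ?_
    rw [div_le_div_iff₀ (by positivity) two_pos]
    nlinarith
  have hset : {ω | |S ω| < n * r} = {ω | n * r ≤ |S ω|}ᶜ := by
    ext ω
    simp
  have hmeas : NullMeasurableSet {ω | n * r ≤ |S ω|} P :=
    nullMeasurableSet_le aemeasurable_const hSmem.1.aemeasurable.norm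
  rw [hset, prob_compl_eq_one_sub₀ hmeas]
  calc (1 / 2 : ℝ≥0∞) = 1 - 1 / 2 := by simp
    _ ≤ _ := tsub_le_tsub_left hhalf 1

theorem eventually_le_measure_empiricalMean_near_of_nonneg (hp : 1 < p) (hindep : iIndepFun X P)
    (hid : ∀ i, IdentDistrib (X i) (signedPow p) P twoSidedExponential) {x ε c : ℝ} (hx : 0 ≤ x)
    (hε : 0 < ε) (hc : x ^ (1 / p) < c) :
    ∀ᶠ n : ℕ in atTop, ENNReal.ofReal (Real.exp (-c * (n : ℝ) ^ (1 / p))) ≤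
      P {ω | |empiricalMean X n ω - x| < ε} := by
  have hp0 : 0 < p := by linarith
  have hv := tendsto_natCast_rpow_one_div hp0
  -- The window `[(n x)^{1/p}, (n (x + ε/2))^{1/p}]` for `Y` grows like `n^{1/p}`, so it eventually
  -- contains the unit interval `[y, y + 1]` used below.
  have hgap : 0 < (x + ε / 2) ^ (1 / p) - x ^ (1 / p) :=
    sub_pos.2 (Real.rpow_lt_rpow hx (by linarith) (by positivity))
  filter_upwards [eventually_gt_atTop 0,
    eventually_half_le_measure_abs_sum_erase_lt hp0 hindep hid (half_pos hε),
    (hv.const_mul_atTop hgap).eventually_ge_atTop 1,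
    (hv.const_mul_atTop (sub_pos.2 hc)).eventually_ge_atTop (1 + Real.log 4)] with n hn h1 h2 h3
  have hn' : (0 : ℝ) < n := by exact_mod_cast hn
  set w := (n : ℝ) ^ (1 / p) with hw
  set y := w * x ^ (1 / p) with hy
  have hy0 : 0 ≤ y := by positivity
  have hroot : ∀ z : ℝ, 0 ≤ z → (w * z ^ (1 / p)) ^ p = n * z := fun z hz => by
    rw [hw, ← Real.mul_rpow hn'.le hz, ← Real.rpow_mul (by positivity),
      one_div_mul_cancel hp0.ne', Real.rpow_one]
  have hjump : ENNReal.ofReal (Real.exp (-(y + 1)) / 2) ≤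
      P (X 0 ⁻¹' Set.Icc (n * x) (n * (x + ε / 2))) := by
    refine (le_measure_Icc hy0).trans (le_trans ?_
      ((hid 0).measure_mem_eq measurableSet_Icc).ge)
    refine measure_mono fun z hz => ?_
    have hz0 : 0 ≤ z := hy0.trans hz.1
    change signedPow p z ∈ Set.Icc (n * x) (n * (x + ε / 2))
    rw [signedPow_of_nonneg hp0 hz0, ← hroot x hx, ← hroot (x + ε / 2) (by linarith)]
    refine ⟨Real.rpow_le_rpow hy0 hz.1 hp0.le, Real.rpow_le_rpow hz0 (hz.2.trans ?_) hp0.le⟩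
    linarith
  set S : Ω → ℝ := ∑ i ∈ (Finset.range n).erase 0, X i with hS
  have hind : IndepFun S (X 0) P :=
    hindep.indepFun_finsetSum_of_notMem₀ (fun i => (hid i).aemeasurable_fst)
      (Finset.notMem_erase 0 _)
  have hsub : S ⁻¹' {z | |z| < n * (ε / 2)} ∩ X 0 ⁻¹' Set.Icc (n * x) (n * (x + ε / 2)) ⊆
      {ω | |empiricalMean X n ω - x| < ε} := by
    rintro ω ⟨hω1, hω2⟩
    have hω1' := abs_lt.1 (show |S ω| < n * (ε / 2) from hω1)
    have hsum : n * (empiricalMean X n ω - x) = X 0 ω + S ω - n * x := by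
      have h4 := Finset.add_sum_erase (Finset.range n) (fun i => X i ω) (Finset.mem_range.2 hn)
      rw [empiricalMean, hS, Finset.sum_apply, h4]
      field_simp
    change |empiricalMean X n ω - x| < ε
    have h5 : n * |empiricalMean X n ω - x| < n * ε := by
      rw [← abs_of_pos hn', ← abs_mul, abs_of_pos hn', hsum, abs_lt]
      have h6 : n * x ≤ X 0 ω := hω2.1
      have h7 : X 0 ω ≤ n * (x + ε / 2) := hω2.2
      have h8 : 0 < n * ε := by positivity
      constructor <;> linarith
    exact lt_of_mul_lt_mul_left h5 hn'.le
  refine le_trans ?_ (measure_mono hsub)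
  have hmeas : MeasurableSet {z : ℝ | |z| < n * (ε / 2)} :=
    measurableSet_lt measurable_norm measurable_const
  rw [hind.measure_inter_preimage_eq_mul _ _ hmeas measurableSet_Icc]
  refine le_trans ?_ (mul_le_mul' h1 hjump)
  rw [show (1 / 2 : ℝ≥0∞) = ENNReal.ofReal (1 / 2) by
      rw [ENNReal.ofReal_div_of_pos two_pos]; simp, ← ENNReal.ofReal_mul (by norm_num)]
  refine ENNReal.ofReal_le_ofReal ?_
  calc Real.exp (-c * w) ≤ Real.exp (-(y + 1) - Real.log 4) :=
        Real.exp_le_exp.2 (by rw [hy]; linarith)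
    _ = 1 / 2 * (Real.exp (-(y + 1)) / 2) := by
        rw [Real.exp_sub, Real.exp_log (by norm_num)]; ring

variable [IsProbabilityMeasure twoSidedExponential]

theorem eventually_measure_le_empiricalMean_le (hp : 1 < p) (hindep : iIndepFun X P)
    (hid : ∀ i, IdentDistrib (X i) (signedPow p) P twoSidedExponential) {b c : ℝ} (hb : 0 < b)
    (hc0 : 0 ≤ c) (hc : c < b ^ (1 / p)) :
    ∀ᶠ n : ℕ in atTop, P {ω | b ≤ empiricalMean X n ω} ≤
      ENNReal.ofReal (Real.exp (-c * (n : ℝ) ^ (1 / p))) := by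
  have hp0 : 0 < p := by linarith
  have hbp : 0 < b ^ (1 / p) := by positivity
  -- A tilt `θ < 1` with `θ b^{1/p} > c` leaves slack `κ`. Each of the two error terms is eventually
  -- at most `e^{κ w} / 2`: the quadratic one has exponent `K n^{1/p-1} w = o(w)`, and the union
  -- bound costs only `n D`.
  obtain ⟨θ, hθc, hθ1⟩ := exists_between ((div_lt_one hbp).2 hc)
  have hθ0 : 0 ≤ θ := (div_nonneg hc0 hbp.le).trans hθc.le
  set κ := θ * b ^ (1 / p) - c with hκ
  have hκ0 : 0 < κ := by rw [div_lt_iff₀ hbp] at hθc; linarith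
  set C := ∫ y, |y| ^ (2 * p) * Real.exp (θ * |y|) ∂twoSidedExponential with hC
  set D := ∫ y, Real.exp (θ * |y|) ∂twoSidedExponential with hD
  have hD0 : 0 < D := integral_exp_pos (integrable_exp_mul_abs hθ1)
  set K := C * (θ * b ^ (1 / p - 1)) ^ 2 with hK
  have hv := tendsto_natCast_rpow_one_div hp0
  have hlim1 : Tendsto (fun n : ℕ => K * (n : ℝ) ^ (1 / p - 1)) atTop (nhds 0) := by
    have h1 : 0 < 1 - 1 / p := by
      rw [sub_pos, div_lt_one hp0]; exact hp
    have h2 := ((tendsto_rpow_neg_atTop h1).comp tendsto_natCast_atTop_atTop).const_mul K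
    simpa [Function.comp_def] using h2
  -- The factor `(n^{1/p})^p` is `n`, written so that polynomial growth is compared with exponential
  -- decay in `w`.
  have hlim2 : Tendsto (fun n : ℕ => ((n : ℝ) ^ (1 / p)) ^ p *
      Real.exp (-κ * (n : ℝ) ^ (1 / p))) atTop (nhds 0) :=
    (tendsto_rpow_mul_exp_neg_mul_atTop_nhds_zero p κ hκ0).comp hv
  filter_upwards [eventually_gt_atTop 0, hlim1.eventually_le_const (half_pos hκ0),
    hlim2.eventually_le_const (show 0 < 1 / (2 * D) by positivity),
    (hv.const_mul_atTop (half_pos hκ0)).eventually_ge_atTop (Real.log 2)] with n hn h1 h2 h3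
  have hn' : (0 : ℝ) < n := by exact_mod_cast hn
  refine (measure_le_empiricalMean_le hp hindep hid hθ0 hθ1 hb hn).trans
    (ENNReal.ofReal_le_ofReal ?_)
  set w := (n : ℝ) ^ (1 / p) with hw
  have hw0 : 0 < w := by positivity
  have hmain : (n * b) ^ (1 / p) = w * b ^ (1 / p) := Real.mul_rpow hn'.le hb.le
  have hA : C * (θ * (n * b) ^ (1 / p - 1)) ^ 2 * n ≤ κ / 2 * w := by
    have h4 : C * (θ * (n * b) ^ (1 / p - 1)) ^ 2 * n = K * (n : ℝ) ^ (1 / p - 1) * w := by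
      rw [Real.mul_rpow hn'.le hb.le, hK]
      have h5 : (n : ℝ) ^ (1 / p - 1) * n = w := by
        rw [Real.rpow_sub_one hn'.ne', div_mul_cancel₀ _ hn'.ne']
      calc _ = C * (θ * b ^ (1 / p - 1)) ^ 2 * (n : ℝ) ^ (1 / p - 1) *
            ((n : ℝ) ^ (1 / p - 1) * n) := by ring
        _ = _ := by rw [h5]
    rw [h4]
    gcongr
  have hA' : Real.exp (C * (θ * (n * b) ^ (1 / p - 1)) ^ 2 * n) ≤ Real.exp (κ * w) / 2 := by
    calc _ ≤ Real.exp (κ * w - Real.log 2) := Real.exp_le_exp.2 (by linarith)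
      _ = _ := by rw [Real.exp_sub, Real.exp_log (by norm_num)]
  have hB : n * D ≤ Real.exp (κ * w) / 2 := by
    have h6 : w ^ p = n := by
      rw [hw, ← Real.rpow_mul hn'.le, one_div_mul_cancel hp0.ne', Real.rpow_one]
    rw [h6, neg_mul, Real.exp_neg, ← div_eq_mul_inv, div_le_div_iff₀ (Real.exp_pos _)
      (by positivity)] at h2
    linarith
  rw [hmain]
  calc _ ≤ Real.exp (-θ * (w * b ^ (1 / p))) * Real.exp (κ * w) := by
        gcongr
        linarith
    _ = Real.exp (-c * w) := by
        rw [← Real.exp_add, hκ]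
        ring_nf

/-- For `p > 1` the deviations of the empirical mean are produced by a single large summand, and
the rate function at speed `n ^ (1 / p)` is `|x| ^ (1 / p)`. -/
theorem satisfiesLDP_empiricalMean_of_one_lt (hp : 1 < p) (hindep : iIndepFun X P)
    (hid : ∀ i, IdentDistrib (X i) (signedPow p) P twoSidedExponential) :
    SatisfiesLDP P (empiricalMean X) (fun n => (n : ℝ) ^ (1 / p))
      (fun x => ((|x| ^ (1 / p) : ℝ) : EReal)) := by
  have hp0 : 0 < p := by linarith
  have hindep' : iIndepFun (fun i ω => -X i ω) P :=
    hindep.comp (fun _ x => -x) fun _ => measurable_neg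
  have hid' : ∀ i, IdentDistrib (fun ω => -X i ω) (signedPow p) P twoSidedExponential := fun i =>
    ((hid i).comp measurable_neg).trans
      (identDistrib_neg (measurable_signedPow p) (signedPow_neg p)).symm
  refine SatisfiesLDP.of_halfLines (tendsto_natCast_rpow_one_div hp0)
    (fun x => by exact_mod_cast Real.rpow_nonneg (abs_nonneg x) _) ?_ ?_ ?_ ?_ ?_
  · exact (continuous_coe_real_ereal.comp (continuous_abs.rpow_const fun _ =>
      Or.inr (by positivity))).lowerSemicontinuous
  · simp [Real.zero_rpow (inv_ne_zero hp0.ne')]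
  · intro b hb c hc0 hc
    rw [EReal.coe_lt_coe_iff, abs_of_pos hb] at hc
    exact eventually_measure_le_empiricalMean_le hp hindep hid hb hc0 hc
  · intro a ha c hc0 hc
    rw [EReal.coe_lt_coe_iff, abs_of_neg ha] at hc
    simpa only [empiricalMean_neg, neg_le_neg_iff] using
      eventually_measure_le_empiricalMean_le hp hindep' hid' (neg_pos.2 ha) hc0 hc
  · intro x ε hε c hc
    rw [EReal.coe_lt_coe_iff] at hc
    rcases le_total 0 x with hx | hx
    · rw [abs_of_nonneg hx] at hc
      exact eventually_le_measure_empiricalMean_near_of_nonneg hp hindep hid hx hε hc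
    · rw [abs_of_nonpos hx] at hc
      have h := eventually_le_measure_empiricalMean_near_of_nonneg hp hindep' hid'
        (neg_nonneg.2 hx) hε hc
      simpa only [empiricalMean_neg, neg_sub_neg, abs_sub_comm x] using h

end twoSidedExponential

/-! ### Transfer to the given variables. -/

theorem proposition1
    {Ω' : Type*} [MeasurableSpace Ω'] (P' : Measure Ω') [IsProbabilityMeasure P']
    (Y : Ω' → ℝ) (hY : HasLaw Y twoSidedExponential P')
    (p : ℝ)
    {Ω : Type*} [MeasurableSpace Ω] (P : Measure Ω) [IsProbabilityMeasure P]
    (X : ℕ → Ω → ℝ) (hindep : iIndepFun X P)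
    (hident : ∀ i, IdentDistrib (X i) (fun ω => signedPow p (Y ω)) P P') :
    (0 < p → p ≤ 1 →
      SatisfiesLDP P (empiricalMean X) (fun n => (n : ℝ))
        (legendre (freeEnergy P' fun ω => signedPow p (Y ω)))) ∧
    (1 < p →
      SatisfiesLDP P (empiricalMean X) (fun n => (n : ℝ) ^ (1 / p))
        (fun x => ((|x| ^ (1 / p) : ℝ) : EReal))) := by
  -- The total mass is read off from the law of `Y`, with no integral of the density.
  have hprob : IsProbabilityMeasure twoSidedExponential :=
    hY.map_eq ▸ Measure.isProbabilityMeasure_map hY.aemeasurable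
  have hm := measurable_signedPow p
  have hYid : IdentDistrib (fun ω => signedPow p (Y ω)) (signedPow p) P' twoSidedExponential := by
    have h : IdentDistrib Y id P' twoSidedExponential :=
      ⟨hY.aemeasurable, aemeasurable_id, by rw [hY.map_eq, Measure.map_id]⟩
    exact h.comp hm
  have hid : ∀ i, IdentDistrib (X i) (signedPow p) P twoSidedExponential :=
    fun i => (hident i).trans hYid
  refine ⟨fun hp hp1 => ?_, fun hp =>
    twoSidedExponential.satisfiesLDP_empiricalMean_of_one_lt hp hindep hid⟩
  have hfree : (freeEnergy P' fun ω => signedPow p (Y ω)) =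
      freeEnergy twoSidedExponential (signedPow p) := by
    funext t
    have h := (hYid.comp (u := fun x => ENNReal.ofReal (Real.exp (t * x)))
      (by fun_prop)).lintegral_eq
    exact congrArg ENNReal.log h
  rw [hfree]
  exact satisfiesLDP_empiricalMean_of_symmetric hindep hid
    (twoSidedExponential.identDistrib_neg hm (signedPow_neg p))
    (twoSidedExponential.exists_deriv_cgf_signedPow_eq hp hp1)
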